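/- A state on $\mathbb{C}^d$ is a positive semidefinite $d\times d$ matrix of trace one, and $\|\rho-\sigma\|_2=\sqrt{\mathrm{Tr}(\rho-\sigma)^2}$. An independent measurement on several copies of states on $\mathbb{C}^d$ is a tensor product $\bigotimes_k\mathcal{M}^{(k)}$ of POVMs with finitely many outcomes, $\mathcal{M}^{(k)}$ acting on the $k$-th copy. We say that an independent measurement on $n$ copies of $\rho$ and $n$ copies of $\sigma$, together with a (deterministic) decision rule on strings of outcomes, is an $\epsilon$-tester if, for all states $\rho,\sigma$ on $\mathbb{C}^d$: when $\rho=\sigma$ it outputs "Yes" with probability at least $\frac23$, and when $\|\rho-\sigma\|_2>\epsilon$ it outputs "No" with probability at least $\frac23$. There is an absolute constant $C>0$ such that for every dimension $d$ the following hold. (1) For every $\epsilon>0$ there is an integer $N\le C\,d/\epsilon^2$ such that for every $n\ge N$ there is an $\epsilon$-tester using an independent measurement on $n$ copies of each of $\rho$ and $\sigma$. That is, $O(d/\epsilon^2)$ copies measured independently suffice to distinguish $\rho=\sigma$ from $\|\rho-\sigma\|_2>\epsilon$ with success probability at least $\frac23$. (2) Let $\{|\beta_{i,j}\rangle\}_{j=1}^d$,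 $0\le i\le d$, be any complete set of $d+1$ mutually unbiased bases of $\mathbb{C}^d$, that is, orthonormal bases with $|\langle\beta_{i,j}|\beta_{s,t}\rangle|^2=\frac1d$ for all $i\ne s$ and all $j,t$, and let $\mathcal{M}$ be the POVM $\left\{\frac{1}{d+1}|\beta_{i,j}\rangle\langle\beta_{i,j}|\right\}_{i,j}$. For states $\rho,\sigma$ on $\mathbb{C}^d$ let $p,q$ be the distributions on the $d(d+1)$ outcomes obtained by measuring $\rho,\sigma$ with $\mathcal{M}$. Then $\|p\|_2\le\frac{\sqrt2}{d+1}$ and $\|p-q\|_2=\frac{\|\rho-\sigma\|_2}{d+1}$. Moreover, for every $\epsilon>0$ there is an integer $N\le C\,d/\epsilon^2$ such that for every $n\ge N$, measuring each of the $n+n$ copies with $\mathcal{M}$ and applying a suitable decision rule to the outcomes is an $\epsilon$-tester. -/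

import Mathlib

namespace QuantumTesting

open scoped ComplexOrder

/-- A density operator on `ℂ^d`: a positive semidefinite matrix of trace one. -/
structure DensityMatrix (d : ℕ) where
  mat : Matrix (Fin d) (Fin d) ℂ
  posSemidef : mat.PosSemidef
  trace_eq_one : mat.trace = 1

/-- A measurement (POVM) on `ℂ^d` with finite outcome set `Ω`. -/
structure POVM (Ω : Type) [Fintype Ω] (d : ℕ) where
  effect : Ω → Matrix (Fin d) (Fin d) ℂ
  posSemidef : ∀ ω, (effect ω).PosSemidef
  sum_eq_one : ∑ ω, effect ω = 1

/-- The `ℓ₂` distance `√(tr (ρ - σ)²)` of two states. -/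
noncomputable def stateDist {d : ℕ} (ρ σ : DensityMatrix d) : ℝ :=
  Real.sqrt (((ρ.mat - σ.mat) * (ρ.mat - σ.mat)).trace.re)

/-- The `ℓ₂` norm of a real function on a finite set. -/
noncomputable def l2Norm {Ω : Type} [Fintype Ω] (p : Ω → ℝ) : ℝ :=
  Real.sqrt (∑ ω, p ω ^ 2)

/-- The outcome distribution of the measurement `M` on one copy of `ρ`. -/
noncomputable def bornProb {Ω : Type} [Fintype Ω] {d : ℕ} (M : POVM Ω d)
    (ρ : DensityMatrix d) (ω : Ω) : ℝ :=
  (M.effect ω * ρ.mat).trace.re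

/-- The tensor product of a finite family of operators on `ℂ^d`. -/
def tensor {κ : Type} [Fintype κ] {d : ℕ} (A : κ → Matrix (Fin d) (Fin d) ℂ) :
    Matrix (κ → Fin d) (κ → Fin d) ℂ :=
  Matrix.of fun i j => ∏ k, A k (i k) (j k)

/-- The probability that the independent measurement `⨂ₖ M k`, performed on the product state
`⨂ₖ r k`, gives the string of outcomes `ω`. -/
noncomputable def outcomeProb {κ Ω : Type} [Fintype κ] [DecidableEq κ] [Fintype Ω] {d : ℕ}
    (M : κ → POVM Ω d) (r : κ → DensityMatrix d) (ω : κ → Ω) : ℝ :=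
  (tensor (fun k => (M k).effect (ω k)) * tensor (fun k => (r k).mat)).trace.re

/-- The probability that the (classical, deterministic) decision rule `f`, applied to the outcomes
of the independent measurement `⨂ₖ M k` on `⨂ₖ r k`, outputs `b`. -/
noncomputable def outputProb {κ Ω : Type} [Fintype κ] [DecidableEq κ] [Fintype Ω] {d : ℕ}
    (M : κ → POVM Ω d) (f : (κ → Ω) → Bool) (r : κ → DensityMatrix d) (b : Bool) : ℝ :=
  ∑ ω, if f ω = b then outcomeProb M r ω else 0

/-- `n` copies of `ρ` together with `n` copies of `σ`. -/
def copies {d : ℕ} (n : ℕ) (ρ σ : DensityMatrix d) : Fin n ⊕ Fin n → DensityMatrix d :=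
  Sum.elim (fun _ => ρ) (fun _ => σ)

/-- The independent measurement `M` on `n` copies of each of two unknown states, followed by the
decision rule `f`, distinguishes `ρ = σ` (output `true`) from `‖ρ - σ‖₂ > ε` (output `false`), with
success probability at least `2/3` in either case. -/
def Distinguishes {Ω : Type} [Fintype Ω] {d n : ℕ} (M : Fin n ⊕ Fin n → POVM Ω d)
    (f : (Fin n ⊕ Fin n → Ω) → Bool) (ε : ℝ) : Prop :=
  ∀ ρ σ : DensityMatrix d,
    (ρ = σ → 2 / 3 ≤ outputProb M f (copies n ρ σ) true) ∧
    (ε < stateDist ρ σ → 2 / 3 ≤ outputProb M f (copies n ρ σ) false)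

/-- A family of orthonormal bases of `ℂ^d` is mutually unbiased if `|⟨e, f⟩|² = 1/d` for all
vectors `e`, `f` of two different bases of the family. -/
def MutuallyUnbiased {ι : Type} {d : ℕ}
    (β : ι → OrthonormalBasis (Fin d) ℂ (EuclideanSpace ℂ (Fin d))) : Prop :=
  ∀ i s, i ≠ s → ∀ j t, ‖inner ℂ (β i j) (β s t)‖ ^ 2 = 1 / (d : ℝ)

/-- The projection `|v⟩⟨v|` (for a unit vector `v`). -/
def proj {d : ℕ} (v : EuclideanSpace ℂ (Fin d)) : Matrix (Fin d) (Fin d) ℂ :=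
  Matrix.vecMulVec v.ofLp (star v.ofLp)

theorem sum_proj {d : ℕ} (b : OrthonormalBasis (Fin d) ℂ (EuclideanSpace ℂ (Fin d))) :
    ∑ j, proj (b j) = 1 := by
  ext x y
  have h := b.sum_inner_mul_inner (EuclideanSpace.single x (1 : ℂ)) (EuclideanSpace.single y 1)
  simp only [EuclideanSpace.inner_single_left, EuclideanSpace.inner_single_right] at h
  simpa [proj, Matrix.sum_apply, Matrix.vecMulVec_apply, Matrix.one_apply, Pi.single_apply,
    eq_comm] using h

/-- Measurement of `d + 1` orthonormal bases of `ℂ^d` with equal weights: the POVM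
`|β i j⟩⟨β i j| / (d + 1)`. -/
noncomputable def basesPOVM {d : ℕ}
    (β : Fin (d + 1) → OrthonormalBasis (Fin d) ℂ (EuclideanSpace ℂ (Fin d))) :
    POVM (Fin (d + 1) × Fin d) d where
  effect ω := ((d : ℂ) + 1)⁻¹ • proj (β ω.1 ω.2)
  posSemidef ω := by
    refine (Matrix.posSemidef_vecMulVec_self_star (β ω.1 ω.2).ofLp).smul ?_
    have : ((d : ℂ) + 1)⁻¹ = (((d : ℝ) + 1)⁻¹ : ℝ) := by push_cast; rfl
    rw [this]
    exact_mod_cast (by positivity : (0 : ℝ) ≤ ((d : ℝ) + 1)⁻¹)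
  sum_eq_one := by
    have h : (d : ℂ) + 1 ≠ 0 := by exact_mod_cast Nat.succ_ne_zero d
    rw [← Finset.smul_sum, Fintype.sum_prod_type]
    simp only [sum_proj, Finset.sum_const, Finset.card_univ, Fintype.card_fin]
    rw [← Nat.cast_smul_eq_nsmul ℂ, smul_smul]
    push_cast
    rw [inv_mul_cancel₀ h, one_smul]

end QuantumTesting

open QuantumTesting

open Finset

namespace QuantumTesting

open scoped ComplexOrder

/-! Measuring every copy with one fixed POVM reduces state testing to closeness testing of the
outcome distributions p and q in ℓ₂, which needs O(b/δ²) samples when both ℓ₂ norms are at most b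
(`exists_closeness_tester`). The POVM of a complete set of mutually unbiased bases in dimension D
has b = √2/(D+1) and scales ℓ₂ distances by exactly 1/(D+1), so with δ = ε/(D+1) the cost is
O(D/ε²).

Classical part: take two disjoint blocks of samples, each with m from p and m from q. The signed
count vectors of the blocks are independent, each with mean m(p-q) and covariance mΣ, where Σ is the
sum of the one-sample covariances of p and q. Their inner product Z therefore has mean m²‖p-q‖² and
variance 2m³⟨p-q, Σ(p-q)⟩ + m²‖Σ‖²; both terms are controlled by b, and Chebyshev's inequality
applies.

Quantum part: the design identity ∑ tr(PA)P = A + tr(A)1 over the basis projections P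
(`designMap_eq_one`), paired with A, gives ∑ tr(PA)² = tr(A²) + tr(A)². For a state the right side
is at most 2; for a difference of states it is the squared distance.

For a general dimension d, Bertrand's postulate gives an odd prime D = O(d). There quadratic Gauss
sums yield a complete set of mutually unbiased bases, and its POVM is compressed along an isometry
from ℂ^d to ℂ^D. -/

/-- Exchanging the coordinates outside `s` of two points. -/
def swapOutside {κ Ω : Type} [DecidableEq κ] (s : Finset κ)
    (x : (κ → Ω) × (κ → Ω)) : (κ → Ω) × (κ → Ω) :=
  (fun k => if k ∈ s then x.1 k else x.2 k, fun k => if k ∈ s then x.2 k else x.1 k)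

theorem swapOutside_involutive {κ Ω : Type} [DecidableEq κ] (s : Finset κ) :
    Function.Involutive (swapOutside (Ω := Ω) s) := by
  intro x
  ext k <;> simp only [swapOutside] <;> split_ifs <;> rfl

theorem dependsOn_sum_eval {κ Ω : Type} (A : Finset κ) (f : κ → Ω → ℝ) :
    DependsOn (fun z : κ → Ω => ∑ k ∈ A, f k (z k)) A :=
  fun _ _ h => sum_congr rfl fun k hk => by rw [h k (mem_coe.2 hk)]

theorem dependsOn_eval {κ Ω : Type} (i : κ) (f : Ω → ℝ) :
    DependsOn (fun z : κ → Ω => f (z i)) ({i} : Finset κ) :=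
  fun _ _ h => by simp only [h i (by simp)]

/-! ### Expectations under product distributions. -/

section ProductExpectation

variable {κ Ω : Type} [Fintype κ] [DecidableEq κ] [Fintype Ω]

/-- The expectation of `F` when the coordinates `z k` are independent with weights `w k`. -/
noncomputable def prodExp (w : κ → Ω → ℝ) (F : (κ → Ω) → ℝ) : ℝ :=
  ∑ z, (∏ k, w k (z k)) * F z

theorem prodExp_const {w : κ → Ω → ℝ} (hw : ∀ k, ∑ ω, w k ω = 1) (c : ℝ) :
    prodExp w (fun _ => c) = c := by
  have h := Fintype.prod_sum w
  simp only [hw, prod_const_one] at h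
  rw [prodExp, ← Finset.sum_mul, ← h, one_mul]

theorem prodExp_add (w : κ → Ω → ℝ) (F G : (κ → Ω) → ℝ) :
    prodExp w (fun z => F z + G z) = prodExp w F + prodExp w G := by
  simp [prodExp, mul_add, sum_add_distrib]

theorem prodExp_const_mul (w : κ → Ω → ℝ) (c : ℝ) (F : (κ → Ω) → ℝ) :
    prodExp w (fun z => c * F z) = c * prodExp w F := by
  simp only [prodExp, mul_sum]
  exact sum_congr rfl fun _ _ => by ring

theorem prodExp_sum {ι : Type} (w : κ → Ω → ℝ) (s : Finset ι) (F : ι → (κ → Ω) → ℝ) :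
    prodExp w (fun z => ∑ i ∈ s, F i z) = ∑ i ∈ s, prodExp w (F i) := by
  simp only [prodExp, mul_sum]
  exact sum_comm

theorem prodExp_mono {w : κ → Ω → ℝ} (hw : ∀ k ω, 0 ≤ w k ω) {F G : (κ → Ω) → ℝ}
    (h : ∀ z, F z ≤ G z) : prodExp w F ≤ prodExp w G :=
  sum_le_sum fun z _ => mul_le_mul_of_nonneg_left (h z) (prod_nonneg fun k _ => hw k _)

theorem prodExp_eval {w : κ → Ω → ℝ} (hw : ∀ k, ∑ ω, w k ω = 1) (i : κ) (f : Ω → ℝ) :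
    prodExp w (fun z => f (z i)) = ∑ ω, w i ω * f ω := by
  have h := Fintype.prod_sum fun k ω => w k ω * if k = i then f ω else 1
  have h1 : ∀ k, (∑ ω, w k ω * if k = i then f ω else 1) =
      if k = i then ∑ ω, w i ω * f ω else 1 := by
    intro k
    split_ifs with hk
    · rw [hk]
    · simp [hw]
  simp only [h1, prod_ite_eq', mem_univ, if_true, prod_mul_distrib] at h
  exact h.symm

/-- Functions of disjoint sets of coordinates are independent. -/
theorem prodExp_mul {w : κ → Ω → ℝ} (hw : ∀ k, ∑ ω, w k ω = 1) {s t : Finset κ}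
    (hst : Disjoint s t) {F G : (κ → Ω) → ℝ} (hF : DependsOn F s) (hG : DependsOn G t) :
    prodExp w (fun z => F z * G z) = prodExp w F * prodExp w G := by
  have h1 : prodExp w F * prodExp w G =
      ∑ x : (κ → Ω) × (κ → Ω),
        ((∏ k, w k (x.1 k)) * F x.1) * ((∏ k, w k (x.2 k)) * G x.2) := by
    rw [prodExp, prodExp, sum_mul_sum, Fintype.sum_prod_type]
  have h2 : prodExp w (fun z => F z * G z) =
      ∑ x : (κ → Ω) × (κ → Ω),
        ((∏ k, w k (x.1 k)) * (F x.1 * G x.1)) * (∏ k, w k (x.2 k)) := by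
    have h3 := prodExp_const hw 1
    simp only [prodExp, mul_one] at h3
    rw [Fintype.sum_prod_type]
    simp only [← mul_sum, h3, mul_one, prodExp]
  -- Both sides are now expectations over two independent draws. Swapping the coordinates outside
  -- `s` preserves the joint weight, fixes F of the first draw, and turns G of the first draw into G
  -- of the second.
  rw [h1, h2, ← Equiv.sum_comp (swapOutside_involutive (Ω := Ω) s).toPerm]
  refine sum_congr rfl fun x _ => ?_
  have hFx : F (swapOutside s x).1 = F x.1 := hF fun k hk => by
    simp [swapOutside, mem_coe.1 hk]
  have hGx : G (swapOutside s x).1 = G x.2 := hG fun k hk => by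
    simp [swapOutside, disjoint_right.1 hst (mem_coe.1 hk)]
  have hW : (∏ k, w k ((swapOutside s x).1 k)) * ∏ k, w k ((swapOutside s x).2 k) =
      (∏ k, w k (x.1 k)) * ∏ k, w k (x.2 k) := by
    rw [← prod_mul_distrib, ← prod_mul_distrib]
    refine prod_congr rfl fun k _ => ?_
    simp only [swapOutside]
    split_ifs
    · rfl
    · exact mul_comm _ _
  simp only [Function.Involutive.coe_toPerm, hFx, hGx]
  linear_combination F x.1 * G x.2 * hW

/-- Distinct coordinates are independent, so only the diagonal pairs contribute a covariance beyond
the product of the means. -/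
theorem prodExp_sum_mul_sum {w : κ → Ω → ℝ} (hw : ∀ k, ∑ ω, w k ω = 1) (A : Finset κ)
    (f g : κ → Ω → ℝ) :
    prodExp w (fun z => (∑ k ∈ A, f k (z k)) * ∑ k ∈ A, g k (z k)) =
      (∑ k ∈ A, ∑ ω, w k ω * f k ω) * (∑ k ∈ A, ∑ ω, w k ω * g k ω) +
      ∑ k ∈ A, ((∑ ω, w k ω * (f k ω * g k ω)) -
        (∑ ω, w k ω * f k ω) * ∑ ω, w k ω * g k ω) := by
  have h : ∀ i j, prodExp w (fun z => f i (z i) * g j (z j)) =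
      (∑ ω, w i ω * f i ω) * (∑ ω, w j ω * g j ω) +
      if i = j then ((∑ ω, w i ω * (f i ω * g i ω)) -
        (∑ ω, w i ω * f i ω) * ∑ ω, w i ω * g i ω) else 0 := by
    intro i j
    split_ifs with hij
    · subst hij
      rw [prodExp_eval hw i fun ω => f i ω * g i ω]
      ring
    · rw [prodExp_mul hw (disjoint_singleton.2 hij) (dependsOn_eval i (f i))
        (dependsOn_eval j (g j)), prodExp_eval hw, prodExp_eval hw, add_zero]
  simp only [sum_mul_sum, prodExp_sum, h, sum_add_distrib, sum_ite_eq]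
  congr 1
  exact sum_congr rfl fun k hk => by simp [hk]

/-- Chebyshev's inequality for a product distribution. -/
theorem prodExp_indicator_le {w : κ → Ω → ℝ} (hw0 : ∀ k ω, 0 ≤ w k ω)
    (hw : ∀ k, ∑ ω, w k ω = 1) (Z : (κ → Ω) → ℝ) {t : ℝ} (ht : 0 < t)
    (P : (κ → Ω) → Prop) [DecidablePred P]
    (hP : ∀ z, P z → t ≤ |Z z - prodExp w Z|) :
    prodExp w (fun z => if P z then 1 else 0) ≤
      (prodExp w (fun z => Z z ^ 2) - prodExp w Z ^ 2) / t ^ 2 := by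
  set m := prodExp w Z with hm
  have h1 : prodExp w (fun z => Z z ^ 2) - m ^ 2 = prodExp w (fun z => (Z z - m) ^ 2) := by
    have : ∀ z, (Z z - m) ^ 2 = Z z ^ 2 + ((-2 * m) * Z z + m ^ 2) := fun z => by ring
    simp only [this, prodExp_add, prodExp_const_mul, prodExp_const hw, ← hm]
    ring
  rw [le_div_iff₀ (by positivity), h1, mul_comm, ← prodExp_const_mul]
  refine prodExp_mono hw0 fun z => ?_
  split_ifs with h
  · have := hP z h
    rw [mul_one, ← sq_abs (Z z - m)]
    gcongr
  · rw [mul_zero]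
    positivity

end ProductExpectation

/-! ### Closeness testing of distributions in ℓ₂. -/

/-- The signed count of the outcome `ω` in the samples belonging to `A` and `B`. -/
def signedCount {κ Ω : Type} [DecidableEq Ω] (A : Finset κ) (s : κ → ℝ) (z : κ → Ω) (ω : Ω) : ℝ :=
  ∑ k ∈ A, s k * if z k = ω then 1 else 0

theorem dependsOn_signedCount {κ Ω : Type} [DecidableEq Ω] (A : Finset κ) (s : κ → ℝ) (ω : Ω) :
    DependsOn (fun z => signedCount A s z ω) A :=
  dependsOn_sum_eval A fun k x => s k * if x = ω then 1 else 0

/-- The inner product of the signed counts of two blocks of samples. -/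
def blockStatistic {κ Ω : Type} [Fintype Ω] [DecidableEq Ω] (A B : Finset κ) (s : κ → ℝ) (z : κ → Ω) : ℝ :=
  ∑ ω, signedCount A s z ω * signedCount B s z ω

section ClosenessTesting

variable {Ω : Type} [Fintype Ω]

/-- The quadratic form equals ∑ (p+q)μ² - ⟨μ,p⟩² - ⟨μ,q⟩²; drop the two squares and bound p+q by 2b.
This controls the variance term that grows with the distance. -/
theorem covariance_apply_le {p q : Ω → ℝ} [DecidableEq Ω] {b : ℝ}
    (hpb : ∀ ω, p ω ≤ b) (hqb : ∀ ω, q ω ≤ b)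
    (μ : Ω → ℝ) :
    ∑ ω, ∑ ω', μ ω * μ ω' * ((if ω = ω' then p ω + q ω else 0) - p ω * p ω' - q ω * q ω') ≤
      2 * b * ∑ ω, μ ω ^ 2 := by
  have h : ∑ ω, ∑ ω', μ ω * μ ω' *
        ((if ω = ω' then p ω + q ω else 0) - p ω * p ω' - q ω * q ω') =
      ∑ ω, (p ω + q ω) * μ ω ^ 2 - (∑ ω, μ ω * p ω) ^ 2 - (∑ ω, μ ω * q ω) ^ 2 := by
    simp only [sq (∑ ω, _), sum_mul_sum, ← sum_sub_distrib]
    refine sum_congr rfl fun ω _ => ?_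
    have : (p ω + q ω) * μ ω ^ 2 = ∑ ω', if ω = ω' then μ ω * μ ω' * (p ω + q ω) else 0 := by
      rw [sum_ite_eq]; simp; ring
    rw [this, ← sum_sub_distrib, ← sum_sub_distrib]
    refine sum_congr rfl fun ω' _ => ?_
    split_ifs <;> ring
  rw [h, mul_sum]
  have : ∑ ω, (p ω + q ω) * μ ω ^ 2 ≤ ∑ ω, 2 * b * μ ω ^ 2 :=
    sum_le_sum fun ω _ => by
      have := hpb ω
      have := hqb ω
      gcongr
      linarith
  nlinarith [sq_nonneg (∑ ω, μ ω * p ω), sq_nonneg (∑ ω, μ ω * q ω)]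

/-- Expand by (x+y-u-v)² ≤ 4(x²+y²+u²+v²). The rank-one parts contribute (∑ p²)² and (∑ q²)², which
are at most ∑ p² and ∑ q² since these sums are at most 1. -/
theorem covariance_sq_le {p q : Ω → ℝ} [DecidableEq Ω] {b : ℝ}
    (hp0 : ∀ ω, 0 ≤ p ω) (hq0 : ∀ ω, 0 ≤ q ω) (hp : ∑ ω, p ω = 1) (hq : ∑ ω, q ω = 1)
    (hpb : ∑ ω, p ω ^ 2 ≤ b ^ 2) (hqb : ∑ ω, q ω ^ 2 ≤ b ^ 2) :
    ∑ ω, ∑ ω', ((if ω = ω' then p ω + q ω else 0) - p ω * p ω' - q ω * q ω') ^ 2 ≤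
      16 * b ^ 2 := by
  have le1 : ∀ r : Ω → ℝ, (∀ ω, 0 ≤ r ω) → ∑ ω, r ω = 1 → ∑ ω, r ω ^ 2 ≤ 1 := by
    intro r h0 h1
    have := sum_sq_le_sq_sum_of_nonneg (s := univ) (f := r) fun i _ => h0 i
    simpa [h1] using this
  have h : ∑ ω, ∑ ω', ((if ω = ω' then p ω + q ω else 0) - p ω * p ω' - q ω * q ω') ^ 2 ≤
      ∑ ω, ∑ ω', (4 * (if ω = ω' then p ω ^ 2 else 0) + 4 * (if ω = ω' then q ω ^ 2 else 0) +
        4 * (p ω ^ 2 * p ω' ^ 2) + 4 * (q ω ^ 2 * q ω' ^ 2)) := by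
    refine sum_le_sum fun ω _ => sum_le_sum fun ω' _ => ?_
    have key : ∀ x y u v : ℝ, (x + y - u - v) ^ 2 ≤ 4 * x ^ 2 + 4 * y ^ 2 + 4 * u ^ 2 + 4 * v ^ 2 := by
      intro x y u v
      nlinarith [sq_nonneg (x - y), sq_nonneg (x + u), sq_nonneg (x + v), sq_nonneg (y + u),
        sq_nonneg (y + v), sq_nonneg (u - v)]
    split_ifs
    · exact (key (p ω) (q ω) (p ω * p ω') (q ω * q ω')).trans_eq (by ring)
    · have := key 0 0 (p ω * p ω') (q ω * q ω')
      simp only [zero_add] at this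
      exact this.trans_eq (by ring)
  refine h.trans ?_
  simp only [sum_add_distrib, ← mul_sum, sum_ite_eq, mem_univ, if_true, ← sum_mul]
  have := le1 p hp0 hp
  have := le1 q hq0 hq
  have : 0 ≤ ∑ ω, p ω ^ 2 := by positivity
  have : 0 ≤ ∑ ω, q ω ^ 2 := by positivity
  nlinarith

variable [DecidableEq Ω] {κ : Type} [Fintype κ] [DecidableEq κ]

theorem prodExp_signedCount {w : κ → Ω → ℝ} (hw : ∀ k, ∑ ω, w k ω = 1)
    (A : Finset κ) (s : κ → ℝ) (ω : Ω) :
    prodExp w (fun z => signedCount A s z ω) = ∑ k ∈ A, s k * w k ω := by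
  simp only [signedCount, prodExp_sum, prodExp_const_mul]
  refine sum_congr rfl fun k _ => ?_
  rw [prodExp_eval hw k fun x => if x = ω then 1 else 0]
  simp

theorem prodExp_signedCount_mul {w : κ → Ω → ℝ} (hw : ∀ k, ∑ ω, w k ω = 1)
    (A : Finset κ) {s : κ → ℝ} (hs : ∀ k, s k ^ 2 = 1) (ω ω' : Ω) :
    prodExp w (fun z => signedCount A s z ω * signedCount A s z ω') =
      (∑ k ∈ A, s k * w k ω) * (∑ k ∈ A, s k * w k ω') +
        ∑ k ∈ A, ((if ω = ω' then w k ω else 0) - w k ω * w k ω') := by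
  have h := prodExp_sum_mul_sum hw A (fun k x => s k * if x = ω then 1 else 0)
    (fun k x => s k * if x = ω' then 1 else 0)
  have h1 : ∀ k (y : Ω), ∑ x, w k x * (s k * if x = y then 1 else 0) = s k * w k y := by
    intro k y
    simp [mul_comm]
  have h2 : ∀ k, ∑ x, w k x * ((s k * if x = ω then 1 else 0) * (s k * if x = ω' then 1 else 0)) =
      if ω = ω' then w k ω else 0 := by
    intro k
    have : ∀ x, w k x * ((s k * if x = ω then 1 else 0) * (s k * if x = ω' then 1 else 0)) =
        if x = ω then (if ω = ω' then w k ω else 0) else 0 := by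
      intro x
      by_cases hx : x = ω
      · subst hx
        rw [if_pos rfl, if_pos rfl]
        split_ifs
        · linear_combination w k x * hs k
        · ring
      · rw [if_neg hx, if_neg hx, mul_zero, zero_mul, mul_zero]
    simp only [this, sum_ite_eq', mem_univ, if_true]
  simp only [h1, h2] at h
  rw [show (fun z => signedCount A s z ω * signedCount A s z ω') = fun z : κ → Ω =>
    (∑ k ∈ A, s k * if z k = ω then 1 else 0) * ∑ k ∈ A, s k * if z k = ω' then 1 else 0 from rfl, h]
  congr 1
  exact sum_congr rfl fun k _ => by linear_combination (-(w k ω * w k ω')) * hs k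

/-- The mean of the block statistic, given the means of the signed counts. -/
theorem prodExp_blockStatistic {w : κ → Ω → ℝ} (hw : ∀ k, ∑ ω, w k ω = 1) {A B : Finset κ}
    (hAB : Disjoint A B) {s : κ → ℝ} {ν : Ω → ℝ} (hA : ∀ ω, ∑ k ∈ A, s k * w k ω = ν ω)
    (hB : ∀ ω, ∑ k ∈ B, s k * w k ω = ν ω) :
    prodExp w (blockStatistic A B s) = ∑ ω, ν ω ^ 2 := by
  change prodExp w (fun z => ∑ ω, signedCount A s z ω * signedCount B s z ω) = _
  simp only [prodExp_sum]
  refine sum_congr rfl fun ω _ => ?_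
  rw [prodExp_mul hw hAB (dependsOn_signedCount A s ω) (dependsOn_signedCount B s ω),
    prodExp_signedCount hw, prodExp_signedCount hw, hA, hB, sq]

/-- Squaring the inner product gives a double sum over outcomes, in which the two independent blocks
contribute equal second moments νν' + c; hence the square of a single expression. -/
theorem prodExp_blockStatistic_sq {w : κ → Ω → ℝ} (hw : ∀ k, ∑ ω, w k ω = 1) {A B : Finset κ}
    (hAB : Disjoint A B) {s : κ → ℝ} (hs : ∀ k, s k ^ 2 = 1) {ν : Ω → ℝ} {c : Ω → Ω → ℝ}
    (hA : ∀ ω, ∑ k ∈ A, s k * w k ω = ν ω) (hB : ∀ ω, ∑ k ∈ B, s k * w k ω = ν ω)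
    (hcA : ∀ ω ω', ∑ k ∈ A, ((if ω = ω' then w k ω else 0) - w k ω * w k ω') = c ω ω')
    (hcB : ∀ ω ω', ∑ k ∈ B, ((if ω = ω' then w k ω else 0) - w k ω * w k ω') = c ω ω') :
    prodExp w (fun z => blockStatistic A B s z ^ 2) =
      ∑ ω, ∑ ω', (ν ω * ν ω' + c ω ω') ^ 2 := by
  have h : ∀ z : κ → Ω, blockStatistic A B s z ^ 2 = ∑ ω, ∑ ω',
      (signedCount A s z ω * signedCount A s z ω') *
        (signedCount B s z ω * signedCount B s z ω') := by
    intro z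
    rw [blockStatistic, sq, sum_mul_sum]
    exact sum_congr rfl fun ω _ => sum_congr rfl fun ω' _ => by ring
  have hdep : ∀ (S : Finset κ) (ω ω' : Ω),
      DependsOn (fun z : κ → Ω => signedCount S s z ω * signedCount S s z ω') S :=
    fun S ω ω' x y hxy => congrArg₂ (· * ·) (dependsOn_signedCount S s ω hxy)
      (dependsOn_signedCount S s ω' hxy)
  simp only [h, prodExp_sum]
  refine sum_congr rfl fun ω _ => sum_congr rfl fun ω' _ => ?_
  rw [prodExp_mul hw hAB (hdep A ω ω') (hdep B ω ω'), prodExp_signedCount_mul hw A hs,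
    prodExp_signedCount_mul hw B hs, hA, hA, hB, hB, hcA, hcB, sq]

/-- `n` samples of `p` and `n` samples of `q`. -/
def samples (n : ℕ) (p q : Ω → ℝ) : Fin n ⊕ Fin n → Ω → ℝ :=
  Sum.elim (fun _ => p) (fun _ => q)

/-- The sign of a sample in the difference of the empirical distributions. -/
def sampleSign (n : ℕ) : Fin n ⊕ Fin n → ℝ :=
  Sum.elim (fun _ => 1) (fun _ => -1)

theorem blockStatistic_moments {n m : ℕ} {A B : Finset (Fin n)} (hAB : Disjoint A B)
    (hA : #A = m) (hB : #B = m) {p q : Ω → ℝ} {b : ℝ}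
    (hp0 : ∀ ω, 0 ≤ p ω) (hq0 : ∀ ω, 0 ≤ q ω) (hp : ∑ ω, p ω = 1) (hq : ∑ ω, q ω = 1)
    (hb : 0 ≤ b) (hpb : ∑ ω, p ω ^ 2 ≤ b ^ 2) (hqb : ∑ ω, q ω ^ 2 ≤ b ^ 2) :
    prodExp (samples n p q) (blockStatistic (A.disjSum A) (B.disjSum B) (sampleSign n)) =
        m ^ 2 * ∑ ω, (p ω - q ω) ^ 2 ∧
      prodExp (samples n p q)
          (fun z => blockStatistic (A.disjSum A) (B.disjSum B) (sampleSign n) z ^ 2) ≤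
        (m ^ 2 * ∑ ω, (p ω - q ω) ^ 2) ^ 2 + 4 * m ^ 3 * b * ∑ ω, (p ω - q ω) ^ 2 +
          16 * m ^ 2 * b ^ 2 := by
  have hw : ∀ k, ∑ ω, samples n p q k ω = 1 := by
    rintro (k | k) <;> simpa [samples]
  have hs : ∀ k, sampleSign n k ^ 2 = 1 := by
    rintro (k | k) <;> simp [sampleSign]
  have hdisj : Disjoint (A.disjSum A) (B.disjSum B) := by
    rw [disjoint_left] at hAB ⊢
    rintro (k | k) <;> simpa using @hAB k
  have hν : ∀ S : Finset (Fin n), #S = m → ∀ ω,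
      ∑ k ∈ S.disjSum S, sampleSign n k * samples n p q k ω = m * (p ω - q ω) := by
    intro S hS ω
    simp [sum_disjSum, sampleSign, samples, hS]
    ring
  have hc : ∀ S : Finset (Fin n), #S = m → ∀ ω ω',
      ∑ k ∈ S.disjSum S, ((if ω = ω' then samples n p q k ω else 0) -
        samples n p q k ω * samples n p q k ω') =
      m * ((if ω = ω' then p ω + q ω else 0) - p ω * p ω' - q ω * q ω') := by
    intro S hS ω ω'
    simp only [sum_disjSum, samples, Sum.elim_inl, Sum.elim_inr, sum_const, hS, nsmul_eq_mul]
    split_ifs <;> ring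
  have hle : ∀ r : Ω → ℝ, (∀ ω, 0 ≤ r ω) → ∑ ω, r ω ^ 2 ≤ b ^ 2 → ∀ ω, r ω ≤ b := by
    intro r h0 h ω
    refine le_of_sq_le_sq ?_ hb
    exact (single_le_sum (f := fun ω => r ω ^ 2) (fun i _ => sq_nonneg _) (mem_univ ω)).trans h
  constructor
  · rw [prodExp_blockStatistic hw hdisj (hν A hA) (hν B hB), mul_sum]
    exact sum_congr rfl fun ω _ => by ring
  · rw [prodExp_blockStatistic_sq hw hdisj hs (hν A hA) (hν B hB) (hc A hA) (hc B hB)]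
    have h1 := covariance_apply_le (hle p hp0 hpb) (hle q hq0 hqb) (fun ω => p ω - q ω)
    have h2 := covariance_sq_le hp0 hq0 hp hq hpb hqb
    have h3 : ∑ ω, ∑ ω', ((m * (p ω - q ω)) * (m * (p ω' - q ω')) +
          m * ((if ω = ω' then p ω + q ω else 0) - p ω * p ω' - q ω * q ω')) ^ 2 =
        (m ^ 2 * ∑ ω, (p ω - q ω) ^ 2) ^ 2 +
        2 * m ^ 3 * (∑ ω, ∑ ω', (p ω - q ω) * (p ω' - q ω') *
          ((if ω = ω' then p ω + q ω else 0) - p ω * p ω' - q ω * q ω')) +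
        m ^ 2 * ∑ ω, ∑ ω', ((if ω = ω' then p ω + q ω else 0) - p ω * p ω' - q ω * q ω') ^ 2 := by
      rw [mul_pow, sq (∑ ω, (p ω - q ω) ^ 2), sum_mul_sum]
      simp only [mul_sum, ← sum_add_distrib]
      exact sum_congr rfl fun ω _ => sum_congr rfl fun ω' _ => by ring
    rw [h3]
    have h4 := mul_le_mul_of_nonneg_left h1 (by positivity : (0 : ℝ) ≤ 2 * m ^ 3)
    have h5 := mul_le_mul_of_nonneg_left h2 (by positivity : (0 : ℝ) ≤ m ^ 2)
    linarith

/-- Testing closeness of distributions of `ℓ₂` norm at most `b` up to an `ℓ₂` error `δ` takes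
`O(b / δ²)` samples. -/
theorem exists_closeness_tester {n m : ℕ} (hmn : 2 * m ≤ n) {b δ : ℝ} (hb : 0 < b) (hδ : 0 < δ)
    (hm : 100 * b / δ ^ 2 ≤ m) :
    ∃ f : (Fin n ⊕ Fin n → Ω) → Bool, ∀ p q : Ω → ℝ, (∀ ω, 0 ≤ p ω) → (∀ ω, 0 ≤ q ω) →
      ∑ ω, p ω = 1 → ∑ ω, q ω = 1 → l2Norm p ≤ b → l2Norm q ≤ b →
      (p = q → 2 / 3 ≤ prodExp (samples n p q) fun z => if f z = true then 1 else 0) ∧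
      (δ < l2Norm (fun ω => p ω - q ω) →
        2 / 3 ≤ prodExp (samples n p q) fun z => if f z = false then 1 else 0) := by
  classical
  obtain ⟨A, -, hA⟩ := exists_subset_card_eq (s := (univ : Finset (Fin n))) (n := m)
    (by rw [card_univ, Fintype.card_fin]; omega)
  obtain ⟨B, hBs, hB⟩ := exists_subset_card_eq (s := Aᶜ) (n := m)
    (by rw [card_compl, Fintype.card_fin]; omega)
  have hAB : Disjoint A B := (disjoint_compl_right (a := A)).mono_right hBs
  have hm0 : (0 : ℝ) < m := lt_of_lt_of_le (by positivity) hm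
  have hm' : 100 * b ≤ m * δ ^ 2 := by rwa [div_le_iff₀ (by positivity)] at hm
  set Z : (Fin n ⊕ Fin n → Ω) → ℝ :=
    blockStatistic (A.disjSum A) (B.disjSum B) (sampleSign n) with hZ
  -- The threshold is half of m²δ², a lower bound for the mean of Z in the far case; the mean is 0
  -- when p = q.
  refine ⟨fun z => decide (Z z < m ^ 2 * δ ^ 2 / 2), fun p q hp0 hq0 hp hq hpb hqb => ?_⟩
  have hw0 : ∀ k ω, 0 ≤ samples n p q k ω := by
    rintro (k | k) ω <;> simp [samples, hp0, hq0]
  have hw : ∀ k, ∑ ω, samples n p q k ω = 1 := by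
    rintro (k | k) <;> simpa [samples]
  have hl2 : ∀ r : Ω → ℝ, l2Norm r ^ 2 = ∑ ω, r ω ^ 2 := fun r => Real.sq_sqrt (by positivity)
  have hsq : ∀ r : Ω → ℝ, l2Norm r ≤ b → ∑ ω, r ω ^ 2 ≤ b ^ 2 := by
    intro r h
    rw [← hl2]
    exact pow_le_pow_left₀ (Real.sqrt_nonneg _) h 2
  obtain ⟨hE, hE2⟩ := blockStatistic_moments hAB hA hB hp0 hq0 hp hq hb.le (hsq p hpb) (hsq q hqb)
  rw [← hZ] at hE hE2
  have hcompl : ∀ c d : Bool, c ≠ d → (prodExp (samples n p q) fun z =>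
      if decide (Z z < m ^ 2 * δ ^ 2 / 2) = c then 1 else 0) =
      1 - prodExp (samples n p q) fun z =>
        if decide (Z z < m ^ 2 * δ ^ 2 / 2) = d then 1 else 0 := by
    intro c d hcd
    rw [eq_sub_iff_add_eq, ← prodExp_add]
    refine (congrArg (prodExp _) (funext fun z => ?_)).trans (prodExp_const hw 1)
    cases c <;> cases d <;> by_cases h : Z z < m ^ 2 * δ ^ 2 / 2 <;> simp_all
  constructor
  · rintro rfl
    simp only [sub_self, ne_eq, OfNat.ofNat_ne_zero, not_false_eq_true, zero_pow, sum_const_zero,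
      mul_zero, zero_add, add_zero] at hE hE2
    rw [hcompl true false (by simp)]
    have h := prodExp_indicator_le hw0 hw Z (t := m ^ 2 * δ ^ 2 / 2) (by positivity)
      (fun z => decide (Z z < m ^ 2 * δ ^ 2 / 2) = false) (fun z hz => by
        rw [hE, sub_zero]
        exact (not_lt.1 (of_decide_eq_false hz)).trans (le_abs_self _))
    have h2 : (prodExp (samples n p p) (fun z => Z z ^ 2) - prodExp (samples n p p) Z ^ 2) /
        (m ^ 2 * δ ^ 2 / 2) ^ 2 ≤ 1 / 3 := by
      rw [div_le_iff₀ (by positivity), hE]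
      -- The variance is at most 16m²b², so the error is at most 64b²/(mδ²)² ≤ 64/100².
      have : (100 * b) ^ 2 ≤ (m * δ ^ 2) ^ 2 := by gcongr
      have := mul_le_mul_of_nonneg_left this (by positivity : (0 : ℝ) ≤ m ^ 2)
      have : 0 ≤ (m : ℝ) ^ 2 * b ^ 2 := by positivity
      nlinarith
    linarith
  · intro hδ'
    set D := ∑ ω, (p ω - q ω) ^ 2 with hD
    have hDδ : δ ^ 2 < D := by
      rw [hD, ← hl2 fun ω => p ω - q ω]
      gcongr
    have hD0 : 0 < D := lt_trans (by positivity) hDδ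
    rw [hcompl false true (by simp)]
    -- The deviation is measured against the true mean m²D, not m²δ², because the variance also
    -- grows with D. The error is then at most 16b/(mD) + 64b²/(mD)² ≤ 0.16 + 0.0064.
    have h := prodExp_indicator_le hw0 hw Z (t := m ^ 2 * D / 2) (by positivity)
      (fun z => decide (Z z < m ^ 2 * δ ^ 2 / 2) = true) (fun z hz => by
        have h1 := of_decide_eq_true hz
        have h2 : (m : ℝ) ^ 2 * δ ^ 2 ≤ m ^ 2 * D := by gcongr
        rw [hE, abs_sub_comm]
        exact le_trans (by linarith) (le_abs_self _))
    have h2 : (prodExp (samples n p q) (fun z => Z z ^ 2) - prodExp (samples n p q) Z ^ 2) /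
        (m ^ 2 * D / 2) ^ 2 ≤ 1 / 3 := by
      rw [div_le_iff₀ (by positivity), hE]
      have hmD : 100 * b ≤ m * D := hm'.trans (by gcongr)
      have h3 : (100 * b) ^ 2 ≤ (m * D) ^ 2 := by gcongr
      have h4 := mul_le_mul_of_nonneg_left h3 (by positivity : (0 : ℝ) ≤ m ^ 2)
      have h5 := mul_le_mul_of_nonneg_left hmD (by positivity : (0 : ℝ) ≤ m ^ 3 * D)
      have : 0 ≤ (m : ℝ) ^ 4 * D ^ 2 := by positivity
      have : 0 ≤ (m : ℝ) ^ 2 * b ^ 2 := by positivity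
      nlinarith
    linarith

end ClosenessTesting

/-! ### Independent measurements and Born probabilities. -/

theorem tensor_mul_tensor {κ : Type} [Fintype κ] [DecidableEq κ] {d : ℕ}
    (A B : κ → Matrix (Fin d) (Fin d) ℂ) :
    tensor A * tensor B = tensor fun k => A k * B k := by
  ext i j
  simp only [tensor, Matrix.mul_apply, Matrix.of_apply, Fintype.prod_sum, prod_mul_distrib]

theorem trace_tensor {κ : Type} [Fintype κ] [DecidableEq κ] {d : ℕ}
    (A : κ → Matrix (Fin d) (Fin d) ℂ) : (tensor A).trace = ∏ k, (A k).trace := by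
  simp only [tensor, Matrix.trace, Matrix.diag, Matrix.of_apply, Fintype.prod_sum]

/-- Conjugation reverses the product, and cyclicity of the trace restores it. Realness is what lets
the real part of a product of traces factor in `outcomeProb_eq_prod`. -/
theorem trace_mul_eq_ofReal {n : Type} [Fintype n] {A B : Matrix n n ℂ} (hA : A.IsHermitian)
    (hB : B.IsHermitian) : (A * B).trace = (((A * B).trace.re : ℝ) : ℂ) := by
  refine (Complex.conj_eq_iff_re.1 ?_).symm
  change star (A * B).trace = _
  rw [← Matrix.trace_conjTranspose, Matrix.conjTranspose_mul, hA.eq, hB.eq, Matrix.trace_mul_comm]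

open scoped MatrixOrder in
theorem DensityMatrix.exists_eq_conjTranspose_mul_self {d : ℕ} (ρ : DensityMatrix d) :
    ∃ B : Matrix (Fin d) (Fin d) ℂ, ρ.mat = B.conjTranspose * B := by
  simpa [Matrix.star_eq_conjTranspose] using
    CStarAlgebra.nonneg_iff_eq_star_mul_self.1 ρ.posSemidef.nonneg

section Born

variable {Ω : Type} [Fintype Ω] {d : ℕ}

theorem bornProb_nonneg (M : POVM Ω d) (ρ : DensityMatrix d) (ω : Ω) : 0 ≤ bornProb M ρ ω := by
  obtain ⟨B, hB⟩ := ρ.exists_eq_conjTranspose_mul_self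
  have h := ((M.posSemidef ω).mul_mul_conjTranspose_same B).trace_nonneg
  rw [bornProb, hB, ← Matrix.mul_assoc, Matrix.trace_mul_comm, ← Matrix.mul_assoc]
  exact (Complex.le_def.1 h).1

theorem sum_bornProb (M : POVM Ω d) (ρ : DensityMatrix d) : ∑ ω, bornProb M ρ ω = 1 := by
  simp only [bornProb]
  rw [← Complex.re_sum, ← Matrix.trace_sum, ← Finset.sum_mul, M.sum_eq_one, one_mul,
    ρ.trace_eq_one, Complex.one_re]

variable {κ : Type} [Fintype κ] [DecidableEq κ]

theorem outcomeProb_eq_prod (M : κ → POVM Ω d) (r : κ → DensityMatrix d) (ω : κ → Ω) :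
    outcomeProb M r ω = ∏ k, bornProb (M k) (r k) (ω k) := by
  rw [outcomeProb, tensor_mul_tensor, trace_tensor]
  have h : ∀ k, ((M k).effect (ω k) * (r k).mat).trace =
      ((bornProb (M k) (r k) (ω k) : ℝ) : ℂ) := fun k =>
    trace_mul_eq_ofReal ((M k).posSemidef (ω k)).1 (r k).posSemidef.1
  simp only [h]
  rw [← Complex.ofReal_prod, Complex.ofReal_re]

theorem outputProb_eq_prodExp (M : κ → POVM Ω d) (f : (κ → Ω) → Bool) (r : κ → DensityMatrix d)
    (b : Bool) :
    outputProb M f r b =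
      prodExp (fun k => bornProb (M k) (r k)) fun z => if f z = b then 1 else 0 := by
  simp only [outputProb, prodExp, outcomeProb_eq_prod, mul_ite, mul_one, mul_zero]

theorem bornProb_copies (M : POVM Ω d) (n : ℕ) (ρ σ : DensityMatrix d) :
    (fun k => bornProb M (copies n ρ σ k)) = samples n (bornProb M ρ) (bornProb M σ) := by
  funext k
  rcases k with k | k <;> rfl

theorem distinguishes_const_true {n : ℕ} (M : Fin n ⊕ Fin n → POVM Ω d) {ε : ℝ}
    (h : ∀ ρ σ : DensityMatrix d, stateDist ρ σ ≤ ε) : Distinguishes M (fun _ => true) ε := by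
  refine fun ρ σ => ⟨fun _ => ?_, fun h' => absurd h' (h ρ σ).not_gt⟩
  simp only [outputProb_eq_prodExp, if_true]
  rw [prodExp_const fun k => sum_bornProb _ _]
  norm_num

/-- A measurement whose outcome distributions have `ℓ₂` norm at most `b`, and which contracts
`ℓ₂` distances by the factor `a`, gives a tester using `O(b / (a ε)²)` copies. -/
theorem exists_distinguishes (M : POVM Ω d) {a b ε : ℝ} (ha : 0 < a) (hb : 0 < b) (hε : 0 < ε)
    (hMb : ∀ ρ, l2Norm (bornProb M ρ) ≤ b)
    (hMa : ∀ ρ σ, l2Norm (fun ω => bornProb M ρ ω - bornProb M σ ω) = a * stateDist ρ σ)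
    {n m : ℕ} (hmn : 2 * m ≤ n) (hm : 100 * b / (a * ε) ^ 2 ≤ m) :
    ∃ f : (Fin n ⊕ Fin n → Ω) → Bool, Distinguishes (fun _ => M) f ε := by
  classical
  obtain ⟨f, hf⟩ := exists_closeness_tester (Ω := Ω) hmn hb (mul_pos ha hε) hm
  refine ⟨f, fun ρ σ => ?_⟩
  simp only [outputProb_eq_prodExp, bornProb_copies]
  obtain ⟨h1, h2⟩ := hf (bornProb M ρ) (bornProb M σ) (bornProb_nonneg M ρ) (bornProb_nonneg M σ)
    (sum_bornProb M ρ) (sum_bornProb M σ) (hMb ρ) (hMb σ)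
  refine ⟨fun h => h1 (h ▸ rfl), fun h => h2 ?_⟩
  rw [hMa]
  gcongr

end Born

/-- Writing ρ = B*B makes the entries inner products of columns of B, so Cauchy–Schwarz gives
|ρ_xy|² ≤ ρ_xx ρ_yy; summing gives (tr ρ)² = 1. -/
theorem DensityMatrix.trace_sq_re_le_one {d : ℕ} (ρ : DensityMatrix d) :
    (ρ.mat * ρ.mat).trace.re ≤ 1 := by
  obtain ⟨B, hB⟩ := ρ.exists_eq_conjTranspose_mul_self
  have hdiag : ∀ x, (∑ k, ‖B k x‖ ^ 2 : ℝ) = (ρ.mat x x).re := by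
    intro x
    rw [hB, Matrix.mul_apply, Complex.re_sum]
    refine sum_congr rfl fun k _ => ?_
    rw [Matrix.conjTranspose_apply, Complex.star_def, mul_comm, Complex.mul_conj,
      Complex.ofReal_re, Complex.normSq_eq_norm_sq]
  have hentry : ∀ x y, ‖ρ.mat x y‖ ^ 2 ≤ (ρ.mat x x).re * (ρ.mat y y).re := by
    intro x y
    rw [← hdiag, ← hdiag]
    refine le_trans ?_ (sum_mul_sq_le_sq_mul_sq univ (fun k => ‖B k x‖) fun k => ‖B k y‖)
    gcongr
    rw [hB, Matrix.mul_apply]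
    refine (norm_sum_le _ _).trans_eq (sum_congr rfl fun k _ => ?_)
    rw [norm_mul, Matrix.conjTranspose_apply, norm_star]
  have htr : ∑ x, (ρ.mat x x).re = 1 := by
    have := congrArg Complex.re ρ.trace_eq_one
    rwa [Matrix.trace, Complex.re_sum, Complex.one_re] at this
  calc (ρ.mat * ρ.mat).trace.re = ∑ x, ∑ y, ‖ρ.mat x y‖ ^ 2 := by
        simp only [Matrix.trace, Matrix.diag, Matrix.mul_apply, Complex.re_sum]
        refine sum_congr rfl fun x _ => sum_congr rfl fun y _ => ?_
        rw [← ρ.posSemidef.1.apply y x, Complex.star_def, Complex.mul_conj, Complex.ofReal_re,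
          Complex.normSq_eq_norm_sq]
    _ ≤ ∑ x, ∑ y, (ρ.mat x x).re * (ρ.mat y y).re :=
        sum_le_sum fun x _ => sum_le_sum fun y _ => hentry x y
    _ = 1 := by rw [← sum_mul_sum, htr, one_mul]

theorem stateDist_le_two {d : ℕ} (ρ σ : DensityMatrix d) : stateDist ρ σ ≤ 2 := by
  rw [stateDist, Real.sqrt_le_left (by norm_num)]
  -- Parallelogram law: tr(ρ-σ)² = 2 tr ρ² + 2 tr σ² - tr(ρ+σ)² ≤ 4.
  have h : 0 ≤ ((ρ.mat + σ.mat) * (ρ.mat + σ.mat)).trace.re := by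
    have h := (Matrix.posSemidef_conjTranspose_mul_self (ρ.mat + σ.mat)).trace_nonneg
    rw [(ρ.posSemidef.1.add σ.posSemidef.1).eq] at h
    exact (Complex.le_def.1 h).1
  have h1 := ρ.trace_sq_re_le_one
  have h2 := σ.trace_sq_re_le_one
  simp only [mul_add, add_mul, mul_sub, sub_mul, Matrix.trace_add, Matrix.trace_sub, Complex.add_re,
    Complex.sub_re] at h ⊢
  linarith

/-! ### Mutually unbiased bases as a 2-design. -/

section MutuallyUnbiasedBases

variable {d : ℕ} {β : Fin (d + 1) → OrthonormalBasis (Fin d) ℂ (EuclideanSpace ℂ (Fin d))}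

theorem trace_proj_mul_proj (u v : EuclideanSpace ℂ (Fin d)) :
    (proj u * proj v).trace = ((‖inner ℂ u v‖ ^ 2 : ℝ) : ℂ) := by
  have h : (proj u * proj v).trace = inner ℂ u v * inner ℂ v u := by
    rw [proj, proj, Matrix.vecMulVec_mul_vecMulVec, Matrix.trace_vecMulVec]
    simp only [EuclideanSpace.inner_eq_star_dotProduct, dotProduct_smul, smul_eq_mul]
    simp only [dotProduct_comm]
  rw [h, ← inner_conj_symm v u, RCLike.mul_conj]
  norm_cast

theorem isHermitian_proj (v : EuclideanSpace ℂ (Fin d)) : (proj v).IsHermitian :=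
  (Matrix.posSemidef_vecMulVec_self_star v.ofLp).1

theorem trace_proj {v : EuclideanSpace ℂ (Fin d)} (hv : ‖v‖ = 1) : (proj v).trace = 1 := by
  rw [proj, Matrix.trace_vecMulVec, ← EuclideanSpace.inner_eq_star_dotProduct,
    inner_self_eq_norm_sq_to_K, hv]
  norm_num

theorem MutuallyUnbiased.trace_mul (hβ : MutuallyUnbiased β) (ω ω' : Fin (d + 1) × Fin d) :
    (proj (β ω.1 ω.2) * proj (β ω'.1 ω'.2)).trace =
      if ω.1 = ω'.1 then (if ω.2 = ω'.2 then 1 else 0) else (d : ℂ)⁻¹ := by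
  obtain ⟨i, j⟩ := ω
  obtain ⟨s, t⟩ := ω'
  rw [trace_proj_mul_proj]
  by_cases h : i = s
  · subst h
    simp only [if_true, orthonormal_iff_ite.1 (β i).orthonormal]
    split_ifs <;> simp
  · simp only [h, if_false, hβ i s h]
    push_cast
    rw [one_div]

/-- The map `A ↦ ∑ tr(P A) P - tr(A) 1`, the sum being over the projections `P` onto the vectors of
the bases. It is the identity if and only if these vectors form a complex projective 2-design. -/
noncomputable def designMap
    (β : Fin (d + 1) → OrthonormalBasis (Fin d) ℂ (EuclideanSpace ℂ (Fin d))) :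
    Module.End ℂ (Matrix (Fin d) (Fin d) ℂ) :=
  ∑ ω : Fin (d + 1) × Fin d,
      ((Matrix.traceLinearMap (Fin d) ℂ ℂ).comp
        (LinearMap.mulLeft ℂ (proj (β ω.1 ω.2)))).smulRight (proj (β ω.1 ω.2)) -
    (Matrix.traceLinearMap (Fin d) ℂ ℂ).smulRight 1

theorem designMap_apply (A : Matrix (Fin d) (Fin d) ℂ) :
    designMap β A = ∑ ω : Fin (d + 1) × Fin d,
      (proj (β ω.1 ω.2) * A).trace • proj (β ω.1 ω.2) - A.trace • 1 := by
  simp [designMap]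

theorem trace_proj_basis (ω : Fin (d + 1) × Fin d) : (proj (β ω.1 ω.2)).trace = 1 :=
  trace_proj ((β ω.1).orthonormal.1 ω.2)

/-- The basis containing P returns P, and each of the d other bases returns 1/d times the identity;
these add up to the identity, which the subtracted trace term cancels. -/
theorem designMap_proj (hβ : MutuallyUnbiased β) (ω : Fin (d + 1) × Fin d) :
    designMap β (proj (β ω.1 ω.2)) = proj (β ω.1 ω.2) := by
  have hd : (d : ℂ) ≠ 0 := by exact_mod_cast (Fin.pos ω.2).ne'
  rw [designMap_apply, trace_proj_basis, Fintype.sum_prod_type,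
    ← add_sum_erase univ _ (mem_univ ω.1)]
  have h1 : ∑ j, (proj (β ω.1 j) * proj (β ω.1 ω.2)).trace • proj (β ω.1 j) =
      proj (β ω.1 ω.2) := by
    have := fun j => hβ.trace_mul (ω.1, j) ω
    simp only [if_true] at this
    simp [this]
  have h2 : ∀ i ∈ univ.erase ω.1,
      ∑ j, (proj (β i j) * proj (β ω.1 ω.2)).trace • proj (β i j) = (d : ℂ)⁻¹ • 1 := by
    intro i hi
    have := fun j => hβ.trace_mul (i, j) ω
    simp only [ne_of_mem_erase hi, if_false] at this
    simp only [this, ← smul_sum, sum_proj]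
  rw [h1, sum_congr rfl h2, sum_const, card_erase_of_mem (mem_univ _), card_univ, Fintype.card_fin,
    Nat.add_sub_cancel, ← Nat.cast_smul_eq_nsmul ℂ, smul_smul, mul_inv_cancel₀ hd, add_sub_cancel_right]

theorem designMap_one : designMap β 1 = 1 := by
  simp only [designMap_apply, mul_one, trace_proj_basis, one_smul, Fintype.sum_prod_type, sum_proj,
    sum_const, card_univ, Fintype.card_fin, Matrix.trace_one]
  rw [← Nat.cast_smul_eq_nsmul ℂ]
  push_cast
  rw [add_smul, one_smul, add_sub_cancel_left]

/-- The image lies in the span of the basis projections and the identity, all of which are fixed. -/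
theorem isIdempotentElem_designMap (hβ : MutuallyUnbiased β) :
    IsIdempotentElem (designMap β) := by
  refine LinearMap.ext fun A => ?_
  change designMap β (designMap β A) = designMap β A
  conv_lhs => rw [designMap_apply A]
  simp only [map_sub, map_sum, map_smul, designMap_proj hβ, designMap_one, designMap_apply A]

/-- Each A ↦ tr(PA)P has trace tr(P²) = 1, so the total is d(d+1) - d. -/
theorem trace_designMap (hβ : MutuallyUnbiased β) :
    LinearMap.trace ℂ _ (designMap β) = (d : ℂ) ^ 2 := by
  simp only [designMap, map_sub, map_sum, LinearMap.trace_smulRight, LinearMap.comp_apply,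
    LinearMap.mulLeft_apply, Matrix.traceLinearMap_apply, Matrix.trace_one, hβ.trace_mul]
  simp
  ring

/-- A complete set of mutually unbiased bases is a complex projective 2-design. -/
theorem designMap_eq_one (hβ : MutuallyUnbiased β) : designMap β = 1 := by
  refine (sub_eq_zero.1 ?_).symm
  -- The complementary idempotent has trace d² - d² = 0, and in characteristic zero the trace of an
  -- idempotent is its rank. No separate proof that the projections span is needed.
  refine LinearMap.IsIdempotentElem.eq_zero_of_trace_eq_zero
    (isIdempotentElem_designMap hβ).one_sub ?_
  rw [map_sub, trace_designMap hβ, LinearMap.trace_one, Module.finrank_matrix]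
  simp
  ring

theorem MutuallyUnbiased.sum_trace_sq (hβ : MutuallyUnbiased β) {A : Matrix (Fin d) (Fin d) ℂ}
    (hA : A.IsHermitian) :
    ∑ ω : Fin (d + 1) × Fin d, (proj (β ω.1 ω.2) * A).trace.re ^ 2 =
      (A * A).trace.re + A.trace.re ^ 2 := by
  have h := congrArg (fun T => (T A * A).trace) (designMap_eq_one hβ)
  simp only [designMap_apply, sub_mul, sum_mul, Matrix.trace_sub, Matrix.trace_sum, smul_mul_assoc,
    Matrix.trace_smul, one_mul, Module.End.one_apply, smul_eq_mul] at h
  have h1 : ∀ ω : Fin (d + 1) × Fin d, (proj (β ω.1 ω.2) * A).trace =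
      (((proj (β ω.1 ω.2) * A).trace.re : ℝ) : ℂ) := fun ω =>
    trace_mul_eq_ofReal (isHermitian_proj _) hA
  have h2 : A.trace = ((A.trace.re : ℝ) : ℂ) := by
    have := trace_mul_eq_ofReal hA (Matrix.isHermitian_one (n := Fin d) (α := ℂ))
    rwa [mul_one] at this
  have h3 : ∑ ω : Fin (d + 1) × Fin d,
      (proj (β ω.1 ω.2) * A).trace * (proj (β ω.1 ω.2) * A).trace =
      ((∑ ω : Fin (d + 1) × Fin d, (proj (β ω.1 ω.2) * A).trace.re ^ 2 : ℝ) : ℂ) := by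
    rw [Complex.ofReal_sum]
    exact sum_congr rfl fun ω _ => by rw [Complex.ofReal_pow, ← h1 ω, sq]
  have h4 : A.trace * A.trace = ((A.trace.re ^ 2 : ℝ) : ℂ) := by
    rw [Complex.ofReal_pow, ← h2, sq]
  rw [h3, h4, sub_eq_iff_eq_add] at h
  have h5 := congrArg Complex.re h
  rwa [Complex.add_re, Complex.ofReal_re, Complex.ofReal_re] at h5

theorem bornProb_basesPOVM (ρ : DensityMatrix d) (ω : Fin (d + 1) × Fin d) :
    bornProb (basesPOVM β) ρ ω = ((d : ℝ) + 1)⁻¹ * (proj (β ω.1 ω.2) * ρ.mat).trace.re := by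
  have h : ((d : ℂ) + 1)⁻¹ = (((d : ℝ) + 1)⁻¹ : ℝ) := by push_cast; rfl
  simp only [bornProb, basesPOVM, smul_mul_assoc, Matrix.trace_smul, smul_eq_mul]
  rw [h, Complex.re_ofReal_mul]

theorem MutuallyUnbiased.l2Norm_bornProb_le (hβ : MutuallyUnbiased β) (ρ : DensityMatrix d) :
    l2Norm (bornProb (basesPOVM β) ρ) ≤ Real.sqrt 2 / (d + 1) := by
  have hd : (0 : ℝ) < d + 1 := by positivity
  have h := hβ.sum_trace_sq ρ.posSemidef.1
  have h1 := ρ.trace_sq_re_le_one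
  rw [ρ.trace_eq_one, Complex.one_re] at h
  rw [l2Norm, Real.sqrt_le_left (by positivity), div_pow, Real.sq_sqrt (by norm_num),
    le_div_iff₀ (by positivity)]
  simp only [bornProb_basesPOVM, mul_pow, ← mul_sum, h]
  rw [mul_right_comm, ← mul_pow, inv_mul_cancel₀ hd.ne']
  linarith

theorem MutuallyUnbiased.l2Norm_bornProb_sub (hβ : MutuallyUnbiased β) (ρ σ : DensityMatrix d) :
    l2Norm (fun ω => bornProb (basesPOVM β) ρ ω - bornProb (basesPOVM β) σ ω) =
      stateDist ρ σ / (d + 1) := by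
  have hd : (0 : ℝ) < d + 1 := by positivity
  have h := hβ.sum_trace_sq (ρ.posSemidef.1.sub σ.posSemidef.1)
  rw [Matrix.trace_sub, ρ.trace_eq_one, σ.trace_eq_one] at h
  simp only [sub_self, Complex.zero_re, ne_eq, OfNat.ofNat_ne_zero, not_false_eq_true, zero_pow,
    add_zero, mul_sub (proj _), Matrix.trace_sub, Complex.sub_re] at h
  simp only [l2Norm, bornProb_basesPOVM, ← mul_sub, mul_pow, ← mul_sum, h, stateDist]
  rw [Real.sqrt_mul (by positivity), Real.sqrt_sq (by positivity), div_eq_inv_mul]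

end MutuallyUnbiasedBases

/-! ### Complete sets of mutually unbiased bases in odd prime dimension. -/

section GaussSums

variable {p : ℕ} [Fact p.Prime]

local notation "χ" => ZMod.stdAddChar (N := p)

theorem sum_stdAddChar_mul (b : ZMod p) : ∑ x, χ (b * x) = if b = 0 then (p : ℂ) else 0 := by
  have h := AddChar.sum_mulShift b (ZMod.isPrimitive_stdAddChar p)
  simpa [mul_comm, ZMod.card] using h

/-- Substituting x = y + t in |S|² cancels the y² terms and leaves the character y ↦ χ(2aty), whose
sum vanishes unless t = 0 because 2a is invertible. -/
theorem norm_sq_sum_stdAddChar_quadratic (hp : p ≠ 2) {a : ZMod p} (ha : a ≠ 0) (b : ZMod p) :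
    ‖∑ x, χ (a * x ^ 2 + b * x)‖ ^ 2 = p := by
  have h2 : (2 : ZMod p) ≠ 0 := by
    exact Ring.two_ne_zero (by rwa [ZMod.ringChar_zmod_n])
  have h : (∑ x, χ (a * x ^ 2 + b * x)) * (starRingEnd ℂ) (∑ x, χ (a * x ^ 2 + b * x)) = p := by
    calc _ = ∑ y, ∑ t, χ (a * t ^ 2 + b * t) * χ ((2 * a * t) * y) := by
          rw [map_sum, sum_mul_sum, sum_comm]
          refine sum_congr rfl fun y _ => ?_
          rw [← Equiv.sum_comp (Equiv.addRight y)]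
          refine sum_congr rfl fun t _ => ?_
          rw [← AddChar.map_neg_eq_conj, ← AddChar.map_add_eq_mul, ← AddChar.map_add_eq_mul,
            Equiv.coe_addRight]
          congr 1
          ring
      _ = ∑ t, χ (a * t ^ 2 + b * t) * if t = 0 then (p : ℂ) else 0 := by
          rw [sum_comm]
          refine sum_congr rfl fun t _ => ?_
          rw [← mul_sum, sum_stdAddChar_mul]
          simp [h2, ha]
      _ = p := by simp
  rw [Complex.mul_conj, Complex.normSq_eq_norm_sq] at h
  exact_mod_cast h

/-- The vector with the coordinates `χ (a x² + b x) / √p`. -/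
noncomputable def quadraticPhase (a b : ZMod p) : EuclideanSpace ℂ (Fin p) :=
  WithLp.toLp 2 fun x =>
    ((Real.sqrt p)⁻¹ : ℝ) * χ (a * ZMod.finEquiv p x ^ 2 + b * ZMod.finEquiv p x)

theorem inner_quadraticPhase (a b a' b' : ZMod p) :
    inner ℂ (quadraticPhase a b) (quadraticPhase a' b') =
      (p : ℂ)⁻¹ * ∑ x, χ ((a' - a) * x ^ 2 + (b' - b) * x) := by
  have hp : ((Real.sqrt p)⁻¹ : ℝ) * ((Real.sqrt p)⁻¹ : ℝ) = (p : ℝ)⁻¹ := by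
    rw [← mul_inv, Real.mul_self_sqrt (by positivity)]
  have hp' : (((Real.sqrt p)⁻¹ : ℝ) : ℂ) * (((Real.sqrt p)⁻¹ : ℝ) : ℂ) = (p : ℂ)⁻¹ := by
    rw [← Complex.ofReal_mul, hp]
    push_cast
    rfl
  rw [PiLp.inner_apply, mul_sum, ← Equiv.sum_comp (ZMod.finEquiv p).toEquiv]
  refine sum_congr rfl fun x _ => ?_
  change _ * (starRingEnd ℂ) _ = _
  simp only [quadraticPhase, map_mul, Complex.conj_ofReal, ← AddChar.map_neg_eq_conj]
  rw [mul_mul_mul_comm, hp', ← AddChar.map_add_eq_mul]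
  congr 2
  simp only [RingEquiv.toEquiv_eq_coe, EquivLike.coe_coe]
  ring

theorem norm_quadraticPhase_apply (a b : ZMod p) (x : Fin p) :
    ‖quadraticPhase a b x‖ ^ 2 = 1 / (p : ℝ) := by
  simp only [quadraticPhase, norm_mul, AddChar.norm_apply, mul_one, Complex.norm_real]
  rw [Real.norm_of_nonneg (by positivity), inv_pow, Real.sq_sqrt (by positivity), one_div]

theorem exists_basis_quadraticPhase (a : ZMod p) :
    ∃ b : OrthonormalBasis (Fin p) ℂ (EuclideanSpace ℂ (Fin p)),
      ∀ j, b j = quadraticPhase a (ZMod.finEquiv p j) := by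
  have hp : (p : ℂ) ≠ 0 := by exact_mod_cast (Fact.out : p.Prime).ne_zero
  have h : Orthonormal ℂ fun j : Fin p => quadraticPhase a (ZMod.finEquiv p j) := by
    rw [orthonormal_iff_ite]
    intro i j
    simp only [inner_quadraticPhase, sub_self, zero_mul, zero_add, sum_stdAddChar_mul, sub_eq_zero,
      EmbeddingLike.apply_eq_iff_eq, eq_comm (a := j)]
    split_ifs <;> simp [hp]
  obtain ⟨b, hb⟩ := Orthonormal.exists_orthonormalBasis_extension_of_card_eq
    (ι := Fin p) (v := fun j : Fin p => quadraticPhase a (ZMod.finEquiv p j)) (s := Set.univ)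
    (by simp) (h.comp _ Subtype.val_injective)
  exact ⟨b, fun j => hb j trivial⟩

/-- A complete set of mutually unbiased bases exists in every odd prime dimension. -/
theorem exists_mutuallyUnbiased (hp : p ≠ 2) :
    ∃ β : Fin (p + 1) → OrthonormalBasis (Fin p) ℂ (EuclideanSpace ℂ (Fin p)),
      MutuallyUnbiased β := by
  have hp0 : (p : ℝ) ≠ 0 := by exact_mod_cast (Fact.out : p.Prime).ne_zero
  choose B hB using exists_basis_quadraticPhase (p := p)
  have hstd : ∀ (a : ZMod p) (j t : Fin p),
      ‖inner ℂ (EuclideanSpace.basisFun (Fin p) ℂ j) (B a t)‖ ^ 2 = 1 / (p : ℝ) := by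
    intro a j t
    rw [EuclideanSpace.basisFun_apply, EuclideanSpace.inner_single_left, map_one, one_mul, hB,
      norm_quadraticPhase_apply]
  -- Index 0 is the standard basis, unbiased to every phase basis because phases have flat modulus.
  -- Phase bases with a ≠ a' have overlap |Gauss sum|²/p² = 1/p.
  refine ⟨Fin.cases (EuclideanSpace.basisFun (Fin p) ℂ) fun a => B (ZMod.finEquiv p a), ?_⟩
  intro i s his j t
  induction i using Fin.cases with
  | zero =>
    induction s using Fin.cases with
    | zero => exact absurd rfl his
    | succ a' => exact hstd _ j t
  | succ a =>
    induction s using Fin.cases with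
    | zero =>
      rw [norm_inner_symm]
      exact hstd _ t j
    | succ a' =>
      have ha : ZMod.finEquiv p a' - ZMod.finEquiv p a ≠ 0 := by
        rw [sub_ne_zero]
        exact fun h => his (congrArg Fin.succ ((ZMod.finEquiv p).injective h).symm)
      simp only [Fin.cases_succ, hB, inner_quadraticPhase, norm_mul, mul_pow,
        norm_sq_sum_stdAddChar_quadratic hp ha, norm_inv, Complex.norm_natCast]
      field_simp

end GaussSums

/-! ### Transfer to smaller dimensions along an isometry. -/

section Compression

variable {Ω : Type} [Fintype Ω] {d D : ℕ}

/-- The image of a state under an isometry. -/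
def DensityMatrix.embed (ρ : DensityMatrix d) (V : Matrix (Fin D) (Fin d) ℂ)
    (hV : V.conjTranspose * V = 1) : DensityMatrix D where
  mat := V * ρ.mat * V.conjTranspose
  posSemidef := ρ.posSemidef.mul_mul_conjTranspose_same V
  trace_eq_one := by
    rw [Matrix.trace_mul_comm, ← Matrix.mul_assoc, hV, Matrix.one_mul, ρ.trace_eq_one]

/-- The compression of a measurement along an isometry, with relabelled outcomes. -/
def POVM.compress {Ω' : Type} [Fintype Ω'] (M : POVM Ω D) (V : Matrix (Fin D) (Fin d) ℂ)
    (hV : V.conjTranspose * V = 1) (e : Ω' ≃ Ω) : POVM Ω' d where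
  effect ω := V.conjTranspose * M.effect (e ω) * V
  posSemidef ω := (M.posSemidef (e ω)).conjTranspose_mul_mul_same V
  sum_eq_one := by
    rw [← Matrix.sum_mul, ← Matrix.mul_sum, e.sum_comp M.effect, M.sum_eq_one, Matrix.mul_one, hV]

variable {V : Matrix (Fin D) (Fin d) ℂ} (hV : V.conjTranspose * V = 1)

theorem bornProb_compress {Ω' : Type} [Fintype Ω'] (M : POVM Ω D) (e : Ω' ≃ Ω)
    (ρ : DensityMatrix d) (ω : Ω') :
    bornProb (M.compress V hV e) ρ ω = bornProb M (ρ.embed V hV) (e ω) := by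
  simp only [bornProb, POVM.compress, DensityMatrix.embed]
  rw [Matrix.mul_assoc, Matrix.mul_assoc, Matrix.trace_mul_comm, Matrix.mul_assoc]

theorem stateDist_embed (ρ σ : DensityMatrix d) :
    stateDist (ρ.embed V hV) (σ.embed V hV) = stateDist ρ σ := by
  have h : ∀ A : Matrix (Fin d) (Fin d) ℂ,
      (V * A * V.conjTranspose * (V * A * V.conjTranspose)).trace = (A * A).trace := by
    intro A
    rw [Matrix.trace_mul_comm, Matrix.mul_assoc V A, Matrix.mul_assoc V, Matrix.trace_mul_comm V]
    simp only [Matrix.mul_assoc]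
    rw [hV, Matrix.mul_one, ← Matrix.mul_assoc V.conjTranspose V, hV, Matrix.one_mul]
  simp only [stateDist, DensityMatrix.embed, ← Matrix.mul_sub, ← Matrix.sub_mul, h]

theorem exists_isometry (h : d ≤ D) :
    ∃ V : Matrix (Fin D) (Fin d) ℂ, V.conjTranspose * V = 1 := by
  refine ⟨Matrix.of fun i j => if i = Fin.castLE h j then 1 else 0, ?_⟩
  ext i j
  simp [Matrix.mul_apply, Matrix.one_apply, eq_comm]

end Compression

/-! ### A flat measurement in every dimension, and the copy count. -/

theorem l2Norm_comp_equiv {Ω Ω' : Type} [Fintype Ω] [Fintype Ω'] (e : Ω' ≃ Ω) (p : Ω → ℝ) :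
    l2Norm (fun ω => p (e ω)) = l2Norm p := by
  rw [l2Norm, l2Norm, e.sum_comp fun ω => p ω ^ 2]

theorem isEmpty_densityMatrix_zero : IsEmpty (DensityMatrix 0) :=
  ⟨fun ρ => by simpa [Matrix.trace] using ρ.trace_eq_one⟩

/-- In every dimension there is a measurement with flat outcome distributions that
contracts the `ℓ₂` distance by a constant factor. -/
theorem exists_flat_povm (d : ℕ) :
    ∃ (m D : ℕ) (M : POVM (Fin m) d), D ≤ 4 * d ∧
      (∀ ρ, l2Norm (bornProb M ρ) ≤ Real.sqrt 2 / (D + 1)) ∧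
      ∀ ρ σ, l2Norm (fun ω => bornProb M ρ ω - bornProb M σ ω) = stateDist ρ σ / (D + 1) := by
  rcases Nat.eq_zero_or_pos d with rfl | hd
  · have := isEmpty_densityMatrix_zero
    exact ⟨0, 0, ⟨fun _ => 1, fun ω => ω.elim0, Subsingleton.elim _ _⟩, by simp,
      fun ρ => this.elim ρ, fun ρ => this.elim ρ⟩
  -- Applying Bertrand's postulate to d + 1 rather than d forces D > 2, so D is odd; also D ≤ 2d + 2
  -- ≤ 4d.
  · obtain ⟨D, hD, hdD, hD2⟩ := Nat.exists_prime_lt_and_le_two_mul (d + 1) (by omega)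
    have := Fact.mk hD
    obtain ⟨β, hβ⟩ := exists_mutuallyUnbiased (p := D) (by omega)
    obtain ⟨V, hV⟩ := exists_isometry (show d ≤ D by omega)
    have e := (Fintype.equivFin (Fin (D + 1) × Fin D)).symm
    refine ⟨_, D, (basesPOVM β).compress V hV e, by omega, fun ρ => ?_, fun ρ σ => ?_⟩
    · rw [funext (bornProb_compress hV (basesPOVM β) e ρ),
        l2Norm_comp_equiv e (bornProb (basesPOVM β) (ρ.embed V hV))]
      exact hβ.l2Norm_bornProb_le _
    · simp only [bornProb_compress]
      rw [l2Norm_comp_equiv e fun ω => bornProb (basesPOVM β) (ρ.embed V hV) ω -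
        bornProb (basesPOVM β) (σ.embed V hV) ω, hβ.l2Norm_bornProb_sub, stateDist_embed]

theorem exists_copies_bound {Ω : Type} [Fintype Ω] {d D : ℕ} (M : POVM Ω d) (hD : D ≤ 4 * d)
    (hMb : ∀ ρ, l2Norm (bornProb M ρ) ≤ Real.sqrt 2 / (D + 1))
    (hMa : ∀ ρ σ, l2Norm (fun ω => bornProb M ρ ω - bornProb M σ ω) = stateDist ρ σ / (D + 1))
    {ε : ℝ} (hε : 0 < ε) :
    ∃ N : ℕ, (N : ℝ) ≤ 2008 * d / ε ^ 2 ∧ ∀ n : ℕ, N ≤ n →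
      ∃ f : (Fin n ⊕ Fin n → Ω) → Bool, Distinguishes (fun _ => M) f ε := by
  -- If no pair of states is ε-far, a constant answer with N = 0 works. Otherwise ε < 2 and d ≥ 1,
  -- which makes d/ε² large enough to absorb rounding.
  by_cases h : ∀ ρ σ : DensityMatrix d, stateDist ρ σ ≤ ε
  · exact ⟨0, by rw [Nat.cast_zero]; positivity,
      fun n _ => ⟨_, distinguishes_const_true _ h⟩⟩
  push Not at h
  obtain ⟨ρ, σ, h⟩ := h
  have hε2 : ε < 2 := h.trans_le (stateDist_le_two ρ σ)
  have hd : 1 ≤ d := by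
    rcases Nat.eq_zero_or_pos d with rfl | hd
    · exact isEmpty_densityMatrix_zero.elim ρ
    · exact hd
  have hd' : (1 : ℝ) ≤ d := by exact_mod_cast hd
  have hD' : (D : ℝ) + 1 ≤ 5 * d := by
    have : (D : ℝ) ≤ 4 * d := by exact_mod_cast hD
    linarith
  have hD0 : (0 : ℝ) < D + 1 := by positivity
  -- The factor 2 accounts for the two blocks, and 1000 = 100·2·5 comes from √2 ≤ 2 and D + 1 ≤ 5d.
  -- Rounding up costs at most 2 ≤ 8d/ε², whence 2008.
  refine ⟨2 * ⌈1000 * d / ε ^ 2⌉₊, ?_, fun n hn => ?_⟩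
  · have h1 := (Nat.ceil_lt_add_one (by positivity : 0 ≤ 1000 * (d : ℝ) / ε ^ 2)).le
    have h2 : (1 : ℝ) ≤ 4 * d / ε ^ 2 := by
      rw [le_div_iff₀ (by positivity)]
      nlinarith
    have h3 : 2008 * (d : ℝ) / ε ^ 2 = 2 * (1000 * d / ε ^ 2) + 2 * (4 * d / ε ^ 2) := by ring
    push_cast
    linarith
  · refine exists_distinguishes M (inv_pos.2 hD0) (by positivity) hε hMb
      (fun ρ σ => (hMa ρ σ).trans (div_eq_inv_mul _ _)) hn (le_trans ?_ (Nat.le_ceil _))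
    have h1 : 100 * (Real.sqrt 2 / (D + 1)) / (((D : ℝ) + 1)⁻¹ * ε) ^ 2 =
        100 * (Real.sqrt 2 * (D + 1)) / ε ^ 2 := by
      field_simp
    rw [h1]
    have h2 : Real.sqrt 2 ≤ 2 := by
      rw [Real.sqrt_le_left (by norm_num)]
      norm_num
    have h3 : Real.sqrt 2 * (D + 1) ≤ 2 * (5 * d) := by gcongr
    exact div_le_div_of_nonneg_right (by linarith) (by positivity)

end QuantumTesting

open QuantumTesting
theorem theorem1 :
    ∃ C : ℝ, 0 < C ∧ ∀ d : ℕ,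
      (∀ ε : ℝ, 0 < ε → ∃ N : ℕ, (N : ℝ) ≤ C * d / ε ^ 2 ∧ ∀ n : ℕ, N ≤ n →
        ∃ (m : ℕ) (M : Fin n ⊕ Fin n → POVM (Fin m) d) (f : (Fin n ⊕ Fin n → Fin m) → Bool),
          Distinguishes M f ε) ∧
      ∀ β : Fin (d + 1) → OrthonormalBasis (Fin d) ℂ (EuclideanSpace ℂ (Fin d)),
        MutuallyUnbiased β →
        (∀ ρ : DensityMatrix d, l2Norm (bornProb (basesPOVM β) ρ) ≤ Real.sqrt 2 / (d + 1)) ∧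
        (∀ ρ σ : DensityMatrix d,
          l2Norm (fun ω => bornProb (basesPOVM β) ρ ω - bornProb (basesPOVM β) σ ω) =
            stateDist ρ σ / (d + 1)) ∧
        ∀ ε : ℝ, 0 < ε → ∃ N : ℕ, (N : ℝ) ≤ C * d / ε ^ 2 ∧ ∀ n : ℕ, N ≤ n →
          ∃ f : (Fin n ⊕ Fin n → Fin (d + 1) × Fin d) → Bool,
            Distinguishes (fun _ => basesPOVM β) f ε := by
  refine ⟨2008, by norm_num, fun d => ⟨fun ε hε => ?_, fun β hβ => ?_⟩⟩
  · obtain ⟨m, D, M, hD, hMb, hMa⟩ := exists_flat_povm d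
    obtain ⟨N, hN, h⟩ := exists_copies_bound M hD hMb hMa hε
    exact ⟨N, hN, fun n hn => ⟨m, fun _ => M, h n hn⟩⟩
  · exact ⟨hβ.l2Norm_bornProb_le, hβ.l2Norm_bornProb_sub, fun ε hε =>
      exists_copies_bound _ (by omega) hβ.l2Norm_bornProb_le hβ.l2Norm_bornProb_sub hε⟩
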